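/- Let $G$ be a finite graph and let $\ll$ be a linear order of its vertices. First-Fit reveals the vertices in the order $\ll$ and gives each vertex $v$ the least positive integer that is not the color of a neighbor of $v$ revealed earlier; $\chi_{\mathrm{FF}}(G,\ll)$ denotes the number of colors it uses. The performance ratio of First-Fit on $G$ in the random arrival model is $\mathbb{E}_{\ll}\left[\chi_{\mathrm{FF}}(G,\ll)/\chi(G)\right]$, where $\ll$ is a uniformly random order of the vertices and $\chi(G)$ is the chromatic number. Let $\mathcal{F}$ be the class of forests and let $\mathrm{RFF}_{\mathcal{F}}(n)$ be the maximum of this ratio over all forests with $n$ vertices. For an integer $r \ge 0$ define rooted trees $T^r_1, T^r_2, \ldots$ recursively: $T^r_1$ is a single vertex, and $T^r_{i+1}$ consists of a new root joined to the roots of $r$ disjoint copies of each of $T^r_1, \ldots, T^r_i$. Then: 1. $\mathrm{RFF}_{\mathcal{F}}(n) \ge \left(\tfrac12 - o(1)\right)\cdot \ln n / \ln\ln n$; that is, there is a sequence $\varepsilon_n \to 0$ such that $\mathrm{RFF}_{\mathcal{F}}(n) \ge \left(\tfrac12 - \varepsilon_n\right) \ln n/\ln\ln n$ for all integers $n \ge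 3$. 2. For all integers $r \ge 0$ and $k \ge 1$, $T^r_k$ is a tree with exactly $(r+1)^{k-1}$ vertices. 3. For every integer $k \ge 3$ and $r = \lceil 10 k \ln^3 k\rceil$, First-Fit uses exactly $k$ colors on $T^r_k$ in a uniformly random presentation order with probability at least $1 - 1/\ln k$. 4. These trees are witnesses for the bound: there is a sequence $\delta_k \to 0$ such that for every integer $k \ge 3$, with $r = \lceil 10 k \ln^3 k\rceil$ and $n_k = (r+1)^{k-1}$ the number of vertices of $T^r_k$, the performance ratio of First-Fit on $T^r_k$ is at least $\left(\tfrac12 - \delta_k\right) \ln n_k / \ln\ln n_k$. -/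

import Mathlib

namespace FirstFit

open scoped BigOperators

/-- A presentation order of the vertices: `σ v` is the (zero-based) round in which `v` is
revealed, so `u` comes before `v` iff `σ u < σ v`. -/
abbrev Presentation (V : Type) [Fintype V] : Type := V ≃ Fin (Fintype.card V)

/-- The color given to `v` by First-Fit: the least positive integer that is not the color of a
neighbor of `v` revealed before `v`. -/
noncomputable def color {V : Type} [Fintype V] (G : SimpleGraph V) (σ : Presentation V)
    (v : V) : ℕ :=
  sInf {i : ℕ | 1 ≤ i ∧ ∀ u : V, G.Adj v u → ∀ _ : σ u < σ v, color G σ u ≠ i}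
termination_by (σ v).val

/-- The number of colors used by First-Fit on `G` in the order `σ`. -/
noncomputable def numColors {V : Type} [Fintype V] (G : SimpleGraph V)
    (σ : Presentation V) : ℕ :=
  (Set.range (color G σ)).ncard

open Classical in
/-- The performance ratio of First-Fit on `G`: the expectation of (number of colors used) divided
by the chromatic number of `G`, over a uniformly random presentation order. -/
noncomputable def performanceRatio {V : Type} [Fintype V] (G : SimpleGraph V) : ℝ :=
  𝔼 σ : Presentation V, (numColors G σ : ℝ) / (G.chromaticNumber.toNat : ℝ)

/-- The probability of an event under a uniformly random presentation order. -/
noncomputable def prob {V : Type} [Fintype V] (p : Presentation V → Prop) : ℝ :=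
  (Nat.card {σ : Presentation V // p σ} : ℝ) / (Nat.card (Presentation V) : ℝ)

/-- The maximum performance ratio of First-Fit over the graphs with `n` vertices of a class of
graphs (given, up to isomorphism, by its members on the vertex set `Fin n`). -/
noncomputable def RFF (𝒢 : (n : ℕ) → Set (SimpleGraph (Fin n))) (n : ℕ) : ℝ :=
  sSup (performanceRatio '' 𝒢 n)

/-- The supremum in the definition of `RFF` is a maximum. -/
theorem isGreatest_RFF (𝒢 : (n : ℕ) → Set (SimpleGraph (Fin n))) (n : ℕ)
    (h : (𝒢 n).Nonempty) : IsGreatest (performanceRatio '' 𝒢 n) (RFF 𝒢 n) :=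
  ⟨(h.image _).csSup_mem ((Set.toFinite _).image _),
    fun _ hx => le_csSup ((Set.toFinite _).image _).bddAbove hx⟩

/-- The class of forests. -/
def forests (n : ℕ) : Set (SimpleGraph (Fin n)) := {G | G.IsAcyclic}

/-- A finite graph with a distinguished vertex. -/
structure RootedGraph where
  V : Type
  [fintypeV : Fintype V]
  graph : SimpleGraph V
  root : V

attribute [instance] RootedGraph.fintypeV

/-- Adjacency in the graph made of disjoint copies of the graphs `F i` and one new vertex `none`
that is joined to the root of every copy. -/
def joinAdj {ι : Type} (F : ι → RootedGraph) :
    Option (Σ i, (F i).V) → Option (Σ i, (F i).V) → Prop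
  | none, none => False
  | none, some b => b.2 = (F b.1).root
  | some a, none => a.2 = (F a.1).root
  | some a, some b => ∃ (i : ι) (x y : (F i).V), (F i).graph.Adj x y ∧ a = ⟨i, x⟩ ∧ b = ⟨i, y⟩

/-- The disjoint union of the rooted graphs `F i` together with one new vertex, the new root,
joined to the root of every `F i`. -/
def join {ι : Type} [Fintype ι] (F : ι → RootedGraph) : RootedGraph where
  V := Option (Σ i, (F i).V)
  graph :=
    { Adj := joinAdj F
      symm := ⟨by
        rintro (_ | a) (_ | b) h
        · exact h
        · exact h
        · exact h
        · obtain ⟨i, x, y, hxy, ha, hb⟩ := h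
          exact ⟨i, y, x, hxy.symm, hb, ha⟩⟩
      loopless := ⟨by
        rintro (_ | a) h
        · exact h
        · obtain ⟨i, x, y, hxy, rfl, hb⟩ := h
          simp only [Sigma.mk.injEq, heq_eq_eq, true_and] at hb
          exact hxy.ne hb⟩ }
  root := none

/-- The rooted tree `T^r_k`, for `k ≥ 1`: the root of `T^r_{i+1}` is joined to the roots of `r`
copies of each of `T^r_1, …, T^r_i` (so `T^r_1` is a single vertex). The index `0` is a dummy. -/
noncomputable def tree (r : ℕ) : ℕ → RootedGraph
  | 0 => { V := Unit, graph := ⊥, root := () }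
  | i + 1 => join fun p : Fin i × Fin r => tree r (p.1.val + 1)
termination_by k => k
decreasing_by exact Nat.succ_lt_succ p.1.isLt

theorem tree_succ (r i : ℕ) :
    tree r (i + 1) = join fun p : Fin i × Fin r => tree r (p.1.val + 1) := by
  rw [tree]

/-- The number of copies `r = ⌈10 k ln³ k⌉`. -/
noncomputable def copies (k : ℕ) : ℕ := ⌈10 * (k : ℝ) * Real.log k ^ 3⌉₊

end FirstFit

/-! Rank each vertex of `T^r_k` by the index of the copy that it roots; then the parent is the only
neighbor of larger rank. A vertex of rank `t` gets color at most `t` if it precedes its parent, and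
at most `t + 1` otherwise. The root has no parent and all other ranks are below `k`, so at most `k`
colors ever occur.

For the lower bound, split time into `N` rounds and put each vertex in an independent uniform round;
a random refinement is a uniformly random order (`ncard_mul_le_of_respects`). An assignment is
robust if the root gets its top color under every refinement. When the root of `T^r_{k+1}` lies in a
round `b ≥ k` (counted from zero), it is enough that for every `j < k` some child of type `j + 1` is
robust and in an earlier round (`Robust.join`). A given child falls in round `j` with probability `1
/ N`, and by induction is then robust with probability at least `1 / 2`. By independence all `r`
children of that type fail with probability at most `(1 - 1 / (2 N)) ^ r`; a union bound over types
gives `ncard_not_robust_tree_le`. A root in the first `k` rounds costs a further `k / N`. With `N`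
about `2 k ln k` and `r` about `10 k ln³ k` the total is at most `1 / ln k` (`failure_le`).

Two colors suffice for a forest, so the ratio is at least `k / 2 * (1 - 1 / ln k)`, whereas `ln n_k`
is `(1 + o(1)) k ln k`. For general `n`, take the largest suitable tree and add isolated vertices.
-/

namespace FirstFit

open scoped BigOperators

/-! ### First-Fit with arbitrary arrival times -/

/-- First-Fit for arbitrary arrival times `ρ`; neighbors with the same arrival time ignore each
other. -/
noncomputable def ffColor {V : Type} (G : SimpleGraph V) (ρ : V → ℕ) (v : V) : ℕ :=
  sInf {i : ℕ | 1 ≤ i ∧ ∀ u : V, G.Adj v u → ∀ _ : ρ u < ρ v, ffColor G ρ u ≠ i}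
termination_by ρ v

theorem color_eq_ffColor {V : Type} [Fintype V] (G : SimpleGraph V) (σ : Presentation V) (v : V) :
    color G σ v = ffColor G (fun u => (σ u).val) v := by
  induction h : (σ v).val using Nat.strong_induction_on generalizing v with
  | _ n ih =>
    subst h
    rw [color, ffColor]
    congr 1
    ext i
    refine and_congr_right fun _ => forall_congr' fun u => forall_congr' fun _ =>
      forall_congr' fun hu => ?_
    rw [ih _ hu u rfl]

section

variable {V : Type} (G : SimpleGraph V) (ρ : V → ℕ)

theorem ffColor_mem [Finite V] (v : V) : ffColor G ρ v ∈
    {i : ℕ | 1 ≤ i ∧ ∀ u : V, G.Adj v u → ∀ _ : ρ u < ρ v, ffColor G ρ u ≠ i} := by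
  have hne : {i : ℕ | 1 ≤ i ∧ ∀ u : V, G.Adj v u → ∀ _ : ρ u < ρ v, ffColor G ρ u ≠ i}.Nonempty := by
    obtain ⟨b, hb⟩ := (Set.finite_range (ffColor G ρ)).bddAbove
    refine ⟨b + 1, by omega, fun u _ _ h => ?_⟩
    have := hb ⟨u, rfl⟩
    omega
  have := Nat.sInf_mem hne
  rwa [← ffColor] at this

theorem one_le_ffColor [Finite V] (v : V) : 1 ≤ ffColor G ρ v := (ffColor_mem G ρ v).1

variable {G ρ}

theorem ffColor_ne [Finite V] {u v : V} (h : G.Adj v u) (hlt : ρ u < ρ v) :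
    ffColor G ρ u ≠ ffColor G ρ v := (ffColor_mem G ρ v).2 u h hlt

theorem ffColor_le {v : V} {i : ℕ} (hi : 1 ≤ i)
    (h : ∀ u, G.Adj v u → ρ u < ρ v → ffColor G ρ u ≠ i) : ffColor G ρ v ≤ i := by
  rw [ffColor]
  exact Nat.sInf_le ⟨hi, h⟩

theorem exists_ffColor_eq_of_lt {v : V} {i : ℕ} (hi : 1 ≤ i) (h : i < ffColor G ρ v) :
    ∃ u, G.Adj v u ∧ ρ u < ρ v ∧ ffColor G ρ u = i := by
  by_contra! hc
  exact absurd (ffColor_le hi hc) (by omega)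

/-- If all vertices that are revealed before time `m` and adjacent to the copy of `H` are in that
copy, then First-Fit runs on the copy as it would on `H` alone until time `m`. -/
theorem ffColor_comp {W : Type} (H : SimpleGraph W) (e : W → V) (m : ℕ)
    (h : ∀ x, ρ (e x) ≤ m → ∀ v, ρ v < ρ (e x) → (G.Adj (e x) v ↔ ∃ y, e y = v ∧ H.Adj x y))
    (x : W) (hx : ρ (e x) ≤ m) : ffColor G ρ (e x) = ffColor H (ρ ∘ e) x := by
  induction hn : ρ (e x) using Nat.strong_induction_on generalizing x with
  | _ n ih =>
    subst hn
    rw [ffColor, ffColor]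
    congr 1
    ext i
    refine and_congr_right fun _ => ⟨fun hi y hy hlt => ?_, fun hi u hu hlt => ?_⟩
    · rw [← ih _ hlt y (hlt.le.trans hx) rfl]
      exact hi _ ((h x hx _ hlt).2 ⟨y, rfl, hy⟩) hlt
    · obtain ⟨y, rfl, hy⟩ := (h x hx u hlt).1 hu
      rw [ih _ hlt y (hlt.le.trans hx) rfl]
      exact hi y hy hlt

end

/-! ### Rankings: color bounds, acyclicity, two-colorability -/

/-- A ranking of the vertices in which every vertex has at most one neighbor of larger rank (its
parent) and no neighbor of the same rank. -/
structure IsRanking {V : Type} (G : SimpleGraph V) (t : V → ℕ) : Prop where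
  pos : ∀ v, 1 ≤ t v
  ne : ∀ u v, G.Adj u v → t u ≠ t v
  unique : ∀ u v w, G.Adj u v → G.Adj u w → t u < t v → t u < t w → v = w

namespace IsRanking

variable {V : Type} {G : SimpleGraph V} {t : V → ℕ}

/-- Earlier neighbors are then children that precede their parent `v`, so by induction on arrival
their colors are at most their ranks, hence below `t v`. -/
theorem ffColor_le_of_forall (h : IsRanking G t) (ρ : V → ℕ) (v : V)
    (hv : ∀ u, G.Adj v u → t v < t u → ρ v ≤ ρ u) : ffColor G ρ v ≤ t v := by
  induction hn : ρ v using Nat.strong_induction_on generalizing v with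
  | _ n ih =>
    subst hn
    refine ffColor_le (h.pos v) fun u hu hlt => ?_
    have huv : t u < t v := by
      have := h.ne _ _ hu
      have := fun h' => hv u hu h'
      omega
    have := ih _ hlt u (fun w hw htw => by
      rw [← h.unique u v w hu.symm hw huv htw]; exact hlt.le) rfl
    omega

/-- Earlier children have colors below `t v`, and an earlier parent can block only one of `t v` and
`t v + 1`. -/
theorem ffColor_le_add_one (h : IsRanking G t) (ρ : V → ℕ) (v : V) :
    ffColor G ρ v ≤ t v + 1 := by
  by_cases hv : ∀ u, G.Adj v u → t v < t u → ρ v ≤ ρ u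
  · exact (h.ffColor_le_of_forall ρ v hv).trans (Nat.le_succ _)
  push Not at hv
  obtain ⟨p, hp, htp, hρ⟩ := hv
  have key : ∀ u, G.Adj v u → ρ u < ρ v → u ≠ p → ffColor G ρ u < t v := by
    intro u hu hlt hne
    have huv : t u < t v := by
      have h1 := h.ne _ _ hu
      have h2 := fun h' => h.unique v u p hu hp h' htp
      by_contra h3
      exact hne (h2 (by omega))
    have := h.ffColor_le_of_forall ρ u fun w hw htw => by
      rw [← h.unique u v w hu.symm hw huv htw]; exact hlt.le
    omega
  by_cases hc : ffColor G ρ p = t v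
  · refine ffColor_le (by omega) fun u hu hlt => ?_
    by_cases hup : u = p
    · rw [hup]; omega
    · have := key u hu hlt hup; omega
  · refine (ffColor_le (h.pos v) fun u hu hlt => ?_).trans (Nat.le_succ _)
    by_cases hup : u = p
    · rwa [hup]
    · have := key u hu hlt hup; omega

/-- A vertex of minimal rank on a cycle would have two neighbors of larger rank. -/
theorem isAcyclic (h : IsRanking G t) : G.IsAcyclic := by
  classical
  intro v c hc
  obtain ⟨u, hu, hmin⟩ := Set.exists_min_image {x | x ∈ c.support} t
    (List.finite_toSet _) ⟨v, c.start_mem_support⟩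
  have hc' : (c.rotate u hu).IsCycle := hc.rotate hu
  have hs := SimpleGraph.Walk.adj_snd hc'.not_nil
  have hp := (SimpleGraph.Walk.adj_penultimate hc'.not_nil).symm
  have hlt : ∀ w, w ∈ (c.rotate u hu).support → G.Adj u w → t u < t w := by
    intro w hw hadj
    have h1 := hmin w ((SimpleGraph.Walk.mem_support_rotate_iff c u hu).1 hw)
    have h2 := h.ne _ _ hadj
    omega
  exact hc'.snd_ne_penultimate (h.unique u _ _ hs hp
    (hlt _ (SimpleGraph.Walk.getVert_mem_support _ _) hs)
    (hlt _ (SimpleGraph.Walk.getVert_mem_support _ _) hp))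

/-- First-Fit by decreasing rank meets at most one earlier neighbor per vertex, so it is itself a
2-coloring. -/
theorem colorable_two [Finite V] (h : IsRanking G t) : G.Colorable 2 := by
  obtain ⟨b, hb⟩ := (Set.finite_range t).bddAbove
  have hb' : ∀ v, t v ≤ b := fun v => hb ⟨v, rfl⟩
  set ρ : V → ℕ := fun v => b - t v with hρ
  have hlt : ∀ u v, ρ u < ρ v → t v < t u := fun u v huv => by
    simp only [hρ] at huv; omega
  have hle : ∀ v, ffColor G ρ v ≤ 2 := by
    intro v
    by_contra! hv
    obtain ⟨x, hx, hxv, hx1⟩ := exists_ffColor_eq_of_lt le_rfl (by omega : 1 < ffColor G ρ v)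
    obtain ⟨y, hy, hyv, hy1⟩ := exists_ffColor_eq_of_lt (by omega) hv
    rw [h.unique v x y hx hy (hlt _ _ hxv) (hlt _ _ hyv)] at hx1
    omega
  refine ⟨SimpleGraph.Coloring.mk (fun v => (⟨ffColor G ρ v - 1, ?_⟩ : Fin 2)) ?_⟩
  · have := hle v; omega
  · intro u v huv heq
    have h1 := one_le_ffColor G ρ u
    have h2 := one_le_ffColor G ρ v
    have h3 : ffColor G ρ u = ffColor G ρ v := by
      simp only [Fin.mk.injEq] at heq; omega
    have h4 := h.ne _ _ huv
    have h5 := hb' u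
    have h6 := hb' v
    rcases lt_or_gt_of_ne h4 with h4 | h4
    · exact ffColor_ne (ρ := ρ) huv (by simp only [hρ]; omega) h3.symm
    · exact ffColor_ne (ρ := ρ) huv.symm (by simp only [hρ]; omega) h3

/-- Padding: vertices outside the image are isolated and get rank 1. -/
theorem map {W : Type} (h : IsRanking G t) (e : V ↪ W) :
    IsRanking (G.map e) (Function.extend e t 1) where
  pos v := by
    by_cases hv : ∃ x, e x = v
    · obtain ⟨x, rfl⟩ := hv
      rw [e.injective.extend_apply]; exact h.pos x
    · rw [Function.extend_apply' _ _ _ hv]; exact le_rfl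
  ne := by
    rintro u v ⟨-, x, y, hxy, rfl, rfl⟩
    rw [e.injective.extend_apply, e.injective.extend_apply]
    exact h.ne _ _ hxy
  unique := by
    rintro u v w ⟨-, x, y, hxy, rfl, rfl⟩ ⟨-, x', z, hxz, hx, rfl⟩ h1 h2
    obtain rfl := e.injective hx
    rw [e.injective.extend_apply, e.injective.extend_apply] at h1 h2
    rw [h.unique _ _ _ hxy hxz h1 h2]

end IsRanking

/-! ### Joining rooted graphs under a new root -/

section Join

variable {ι : Type} [Fintype ι] (F : ι → RootedGraph)

theorem join_adj_some_iff {i : ι} {x : (F i).V} {v : (join F).V} :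
    (join F).graph.Adj (some ⟨i, x⟩ : Option _) v ↔
      (v = (none : Option _) ∧ x = (F i).root) ∨
        ∃ y, v = (some ⟨i, y⟩ : Option _) ∧ (F i).graph.Adj x y := by
  change joinAdj F _ _ ↔ _
  rcases v with _ | ⟨j, z⟩
  · simp only [joinAdj, reduceCtorEq, false_and, exists_false, or_false]
    exact ⟨fun h => ⟨rfl, h⟩, fun h => h.2⟩
  · constructor
    · rintro ⟨i', x', y', hadj, h1, h2⟩
      rw [Sigma.mk.injEq] at h1
      obtain ⟨rfl, h1⟩ := h1
      rw [heq_eq_eq] at h1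
      subst h1
      exact Or.inr ⟨y', congrArg some h2, hadj⟩
    · rintro (⟨h, -⟩ | ⟨y, h, hadj⟩)
      · cases h
      · exact ⟨i, x, y, hadj, rfl, Option.some.inj h⟩

theorem join_adj_none_iff {v : (join F).V} :
    (join F).graph.Adj (none : Option _) v ↔ ∃ i, v = (some ⟨i, (F i).root⟩ : Option _) := by
  change joinAdj F _ _ ↔ _
  rcases v with _ | ⟨j, z⟩
  · simp [joinAdj]
  · constructor
    · intro (h : z = (F j).root)
      exact ⟨j, by rw [h]⟩
    · rintro ⟨i, h⟩
      cases h
      rfl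

theorem join_connected (h : ∀ i, (F i).graph.Connected) : (join F).graph.Connected := by
  have key : ∀ v : (join F).V, (join F).graph.Reachable v (none : Option _) := by
    rintro (_ | ⟨i, x⟩)
    · exact SimpleGraph.Reachable.refl _
    · let f : (F i).graph →g (join F).graph :=
        ⟨fun y => (some ⟨i, y⟩ : Option _), fun {a b} hab => ⟨i, a, b, hab, rfl, rfl⟩⟩
      refine ((h i).preconnected x (F i).root |>.map f).trans (SimpleGraph.Adj.reachable ?_)
      exact (join_adj_some_iff F).2 (Or.inl ⟨rfl, rfl⟩)
  exact @SimpleGraph.Connected.mk _ _ (fun u v => (key u).trans (key v).symm) ⟨none⟩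

theorem card_join : Fintype.card (join F).V = (∑ i, Fintype.card (F i).V) + 1 := by
  have : Fintype.card (join F).V = Fintype.card (Option (Σ i, (F i).V)) :=
    Fintype.card_congr (Equiv.refl _)
  rw [this, Fintype.card_option, Fintype.card_sigma]

theorem IsRanking.join {t : ∀ i, (F i).V → ℕ} (ht : ∀ i, IsRanking (F i).graph (t i))
    (hroot : ∀ i x, t i x ≤ t i (F i).root) {k : ℕ} (hk : 1 ≤ k) (htk : ∀ i x, t i x < k) :
    IsRanking (join F).graph
      (fun v : Option (Σ i, (F i).V) => v.elim k (fun p => t p.1 p.2)) where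
  pos := by
    rintro (_ | ⟨i, x⟩)
    · exact hk
    · exact (ht i).pos x
  ne := by
    rintro (_ | ⟨i, x⟩) v hv
    · obtain ⟨i, rfl⟩ := (join_adj_none_iff F).1 hv
      exact (htk i _).ne'
    · obtain ⟨rfl, -⟩ | ⟨y, rfl, hy⟩ := (join_adj_some_iff F).1 hv
      · exact (htk i _).ne
      · exact (ht i).ne x y hy
  unique := by
    rintro (_ | ⟨i, x⟩) v w hv hw h1 h2
    · obtain ⟨i, rfl⟩ := (join_adj_none_iff F).1 hv
      exact absurd h1 (htk i _).not_gt
    · obtain ⟨rfl, hx⟩ | ⟨y, rfl, hy⟩ := (join_adj_some_iff F).1 hv <;>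
        obtain ⟨rfl, hx'⟩ | ⟨z, rfl, hz⟩ := (join_adj_some_iff F).1 hw
      · rfl
      · subst hx
        exact absurd h2 (hroot i z).not_gt
      · subst hx'
        exact absurd h1 (hroot i y).not_gt
      · rw [(ht i).unique x y z hy hz h1 h2]

/-- `τ` assigns the vertices to rounds so that First-Fit gives the root color `k` in every order
that respects the rounds. -/
def Robust (H : RootedGraph) (k : ℕ) {N : ℕ} (τ : H.V → Fin N) : Prop :=
  ∀ ρ : H.V → ℕ, (∀ u v, τ u < τ v → ρ u < ρ v) → ffColor H.graph ρ H.root = k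

variable {F}

theorem ffColor_join_root (ρ : (join F).V → ℕ) {i : ι}
    (h : ρ (some ⟨i, (F i).root⟩ : Option _) < ρ (none : Option _)) :
    ffColor (join F).graph ρ (some ⟨i, (F i).root⟩ : Option _) =
      ffColor (F i).graph (fun x => ρ (some ⟨i, x⟩ : Option _)) (F i).root := by
  refine ffColor_comp (G := (join F).graph) (F i).graph (fun x => (some ⟨i, x⟩ : Option _))
    (ρ (none : Option _)) (fun x hx v hv => ?_) _ h.le
  rw [join_adj_some_iff]
  constructor
  · rintro (⟨rfl, -⟩ | ⟨y, rfl, hy⟩)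
    · exact absurd hx hv.not_ge
    · exact ⟨y, rfl, hy⟩
  · rintro ⟨y, rfl, hy⟩
    exact Or.inr ⟨y, rfl, hy⟩

/-- The ranking caps the root's color at `k + 1`. Any smaller color `j + 1` is already taken by an
earlier child that robustly has it. -/
theorem Robust.join {k N : ℕ} {t : (join F).V → ℕ} (ht : IsRanking (join F).graph t)
    (hroot : t (none : Option _) = k + 1) (hmax : ∀ v, t v ≤ k + 1) {τ : (join F).V → Fin N}
    (h : ∀ j < k, ∃ i, τ (some ⟨i, (F i).root⟩ : Option _) < τ (none : Option _) ∧
      Robust (F i) (j + 1) fun x => τ (some ⟨i, x⟩ : Option _)) :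
    Robust (join F) (k + 1) τ := by
  intro ρ hρ
  change ffColor (FirstFit.join F).graph ρ (none : Option _) = k + 1
  have hle : ffColor (FirstFit.join F).graph ρ (none : Option _) ≤ k + 1 := by
    rw [← hroot]
    refine ht.ffColor_le_of_forall ρ _ fun u _ hu => ?_
    have := hmax u
    omega
  have hpos := one_le_ffColor (FirstFit.join F).graph ρ (none : Option _)
  by_contra hne
  obtain ⟨i, hi, hrob⟩ := h (ffColor (FirstFit.join F).graph ρ (none : Option _) - 1) (by omega)
  have hlt := hρ _ _ hi
  refine ffColor_ne ((join_adj_none_iff F).2 ⟨i, rfl⟩) hlt ?_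
  rw [ffColor_join_root ρ hlt, hrob _ fun u v huv => hρ _ _ huv]
  omega

end Join

/-! ### The trees `T^r_k`: ranking, connectedness, order -/

theorem exists_isRanking_tree (r k : ℕ) : ∃ t : (tree r (k + 1)).V → ℕ,
    IsRanking (tree r (k + 1)).graph t ∧ t (tree r (k + 1)).root = k + 1 ∧
      ∀ v, v ≠ (tree r (k + 1)).root → t v < k + 1 := by
  induction k using Nat.strong_induction_on with
  | _ k ih =>
    have ih' := fun p : Fin k × Fin r => ih p.1.val p.1.isLt
    choose t ht hroot hlt using ih'
    have hle : ∀ i x, t i x ≤ t i (tree r (i.1.val + 1)).root := by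
      intro i x
      by_cases hx : x = (tree r (i.1.val + 1)).root
      · rw [hx]
      · rw [hroot]; exact (hlt i x hx).le
    have hk : ∀ i x, t i x < k + 1 := by
      intro i x
      have := hle i x
      rw [hroot] at this
      have := i.1.isLt
      omega
    rw [tree_succ]
    refine ⟨_, IsRanking.join _ ht hle (Nat.succ_pos k) hk, rfl, ?_⟩
    rintro (_ | ⟨i, x⟩) hv
    · exact absurd rfl hv
    · exact hk i x

theorem tree_connected (r k : ℕ) : (tree r (k + 1)).graph.Connected := by
  induction k using Nat.strong_induction_on with
  | _ k ih =>
    rw [tree_succ]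
    exact join_connected _ fun p => ih p.1.val p.1.isLt

theorem tree_isTree (r k : ℕ) : (tree r (k + 1)).graph.IsTree :=
  ⟨tree_connected r k, (exists_isRanking_tree r k).choose_spec.1.isAcyclic⟩

theorem card_tree (r k : ℕ) : Fintype.card (tree r (k + 1)).V = (r + 1) ^ k := by
  induction k using Nat.strong_induction_on with
  | _ k ih =>
    rw [tree_succ, card_join, Fintype.sum_prod_type]
    have h : ∀ x : Fin k, ∑ y : Fin r, Fintype.card (tree r ((x, y).1.val + 1)).V =
        r * (r + 1) ^ x.val := by
      intro x
      simp [ih x.val x.isLt]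
    rw [Finset.sum_congr rfl fun x _ => h x, ← Finset.mul_sum,
      Fin.sum_univ_eq_sum_range (fun i => (r + 1) ^ i), mul_comm]
    exact geom_sum_mul_add r k

/-! ### From random rounds to random orders -/

/-- Every assignment of vertices to rounds is respected by some presentation order. -/
theorem exists_presentation {V : Type} [Fintype V] {N : ℕ} (τ : V → Fin N) :
    ∃ σ : Presentation V, ∀ u v, τ u < τ v → σ u < σ v := by
  let e := Fintype.equivFin V
  refine ⟨e.trans (Tuple.sort (τ ∘ e.symm)).symm, fun u v huv => ?_⟩
  by_contra h
  have := Tuple.monotone_sort (τ ∘ e.symm) (not_lt.1 h)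
  simp only [Function.comp_apply, Equiv.trans_apply, Equiv.apply_symm_apply,
    Equiv.symm_apply_apply] at this
  exact this.not_gt huv

/-- A uniformly random assignment to rounds, refined to a uniformly random order: if every order
that respects a good assignment is good, then orders are good at least as often as assignments. -/
theorem ncard_mul_le_of_respects {V : Type} [Fintype V] {N : ℕ} (A : Set (V → Fin N))
    (B : Set (Presentation V))
    (h : ∀ τ ∈ A, ∀ σ : Presentation V, (∀ u v, τ u < τ v → σ u < σ v) → σ ∈ B) :
    A.ncard * Nat.card (Presentation V) ≤ B.ncard * Nat.card (V → Fin N) := by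
  classical
  choose s hs using fun τ : V → Fin N => exists_presentation τ
  have hcard : Nat.card (Presentation V) = Fintype.card (Equiv.Perm V) := by
    rw [Nat.card_eq_fintype_card]
    exact Fintype.card_congr ((Equiv.refl V).equivCongr (Fintype.equivFin V).symm)
  have h1 : ∀ π : Equiv.Perm V, {τ : V → Fin N | τ ∘ π ∈ A}.ncard = A.ncard := fun π =>
    Set.ncard_preimage_of_injective_subset_range (f := fun τ : V → Fin N => τ ∘ π)
      (fun a b hab => by
        ext1 v
        simpa using congrFun hab (π.symm v))
      (fun τ _ => ⟨τ ∘ π.symm, by ext1 v; simp⟩)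
  have h2 : ∀ τ : V → Fin N, {π : Equiv.Perm V | τ ∘ π ∈ A}.ncard ≤ B.ncard := by
    intro τ
    refine Set.ncard_le_ncard_of_injOn (fun π : Equiv.Perm V => π.trans (s τ)) ?_ ?_
      (Set.toFinite _)
    · intro π hπ
      exact h _ hπ _ fun u v huv => hs τ _ _ huv
    · intro π _ π' _ hππ
      ext v
      simpa using congrArg (fun σ : Presentation V => σ v) hππ
  -- Double count the pairs `(π, τ)` with `τ ∘ π ∈ A`. For fixed `τ`, the order `π.trans (s τ)`
  -- respects `τ ∘ π`, so it lies in `B`, and it determines `π`.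
  have h3 : ∑ π : Equiv.Perm V, {τ : V → Fin N | τ ∘ π ∈ A}.ncard =
      ∑ τ : V → Fin N, {π : Equiv.Perm V | τ ∘ π ∈ A}.ncard := by
    simp only [Set.ncard_eq_toFinset_card', Set.toFinset_ofPred]
    exact Finset.sum_card_bipartiteAbove_eq_sum_card_bipartiteBelow
      (fun (π : Equiv.Perm V) (τ : V → Fin N) => τ ∘ π ∈ A)
  calc A.ncard * Nat.card (Presentation V)
      = ∑ π : Equiv.Perm V, {τ : V → Fin N | τ ∘ π ∈ A}.ncard := by
        rw [Finset.sum_congr rfl fun π _ => h1 π, Finset.sum_const, Finset.card_univ, hcard,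
          smul_eq_mul, mul_comm]
    _ ≤ ∑ _τ : V → Fin N, B.ncard := h3 ▸ Finset.sum_le_sum fun τ _ => h2 τ
    _ = B.ncard * Nat.card (V → Fin N) := by
        rw [Nat.card_eq_fintype_card, Finset.sum_const, Finset.card_univ, smul_eq_mul, mul_comm]

/-! ### Probability that an assignment is not robust -/

theorem card_mul_ncard_apply_eq {V : Type} [Fintype V] {N : ℕ} (a : V) (b : Fin N) :
    N * {τ : V → Fin N | τ a = b}.ncard = N ^ Fintype.card V := by
  classical
  have : {τ : V → Fin N | τ a = b} =
      (Fintype.piFinset fun v => if v = a then {b} else Finset.univ : Finset (V → Fin N)) := by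
    ext τ
    simp only [Set.mem_ofPred_eq, SetLike.mem_coe, Fintype.mem_piFinset]
    constructor
    · rintro h v
      split_ifs with hv
      · rw [hv, h]; exact Finset.mem_singleton_self b
      · exact Finset.mem_univ _
    · intro h
      simpa using h a
  rw [this, Set.ncard_coe_finset, Fintype.card_piFinset, ← Finset.mul_prod_erase _ _ (Finset.mem_univ a)]
  rw [Finset.prod_congr rfl (g := fun _ => N) fun v hv => by simp [Finset.ne_of_mem_erase hv]]
  simp only [if_true, Finset.card_singleton, one_mul, Finset.prod_const,
    Finset.card_erase_of_mem (Finset.mem_univ a), Finset.card_univ]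
  rw [mul_comm, ← pow_succ, Nat.sub_add_cancel (Fintype.card_pos_iff.2 ⟨a⟩)]

/-- Independence of the copies, in counting form: with the root's round fixed, an assignment is a
tuple of assignments of the copies. -/
theorem ncard_join_le {ι : Type} [Fintype ι] (F : ι → RootedGraph) {N : ℕ} (b : Fin N)
    (s : ∀ i, Set ((F i).V → Fin N)) :
    {τ : (join F).V → Fin N | τ (none : Option _) = b ∧
      ∀ i, (fun x => τ (some ⟨i, x⟩ : Option _)) ∈ s i}.ncard ≤ ∏ i, (s i).ncard := by
  classical
  have hs : ∏ i, (s i).ncard = (Fintype.piFinset fun i => (s i).toFinset).card := by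
    rw [Fintype.card_piFinset]
    exact Finset.prod_congr rfl fun i _ => Set.ncard_eq_toFinset_card' _
  rw [hs, ← Set.ncard_coe_finset]
  refine Set.ncard_le_ncard_of_injOn (fun τ i x => τ (some ⟨i, x⟩ : Option _)) ?_ ?_
    (Set.toFinite _)
  · rintro τ ⟨-, hτ⟩
    simpa using hτ
  · rintro τ ⟨hτ, -⟩ τ' ⟨hτ', -⟩ h
    funext v
    rcases v with _ | ⟨i, x⟩
    · exact hτ.trans hτ'.symm
    · exact congrFun (congrFun h i) x

/-- If the root of `T^r_{k+1}` arrives in round `b ≥ k`, then it gets color `k + 1` except for a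
fraction `k (1 - 1 / (2 N)) ^ r` of the assignments to rounds. -/
theorem ncard_not_robust_tree_le {r N K : ℕ}
    (hK : (K : ℝ) * (1 - 1 / (2 * N)) ^ r ≤ 1 / 2) (k : ℕ) (hk : k ≤ K) (b : Fin N) (hb : k ≤ b.val) :
    (N : ℝ) * ({τ : (tree r (k + 1)).V → Fin N | τ (tree r (k + 1)).root = b ∧
      ¬ Robust (tree r (k + 1)) (k + 1) τ}.ncard : ℝ) ≤
      k * (1 - 1 / (2 * N)) ^ r * (N : ℝ) ^ Fintype.card (tree r (k + 1)).V := by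
  -- `K` stays fixed, so that `hK` serves every smaller index.
  induction k using Nat.strong_induction_on generalizing b with
  | _ k ih =>
  classical
  have hN : (1 : ℝ) ≤ N := by
    have := b.isLt
    exact_mod_cast (by omega : 1 ≤ N)
  set q : ℝ := 1 - 1 / (2 * N) with hq
  have hq0 : 0 ≤ q := by
    have : 1 / (2 * (N : ℝ)) ≤ 1 := by
      rw [div_le_one (by linarith)]; linarith
    linarith
  -- a child of type `j + 1` is unhelpful with probability at most `q`
  have child : ∀ j < k, (({τ : (tree r (j + 1)).V → Fin N | ¬ (τ (tree r (j + 1)).root < b ∧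
      Robust (tree r (j + 1)) (j + 1) τ)}.ncard : ℕ) : ℝ) ≤
      q * (N : ℝ) ^ Fintype.card (tree r (j + 1)).V := by
    intro j hj
    have hjN : j < N := by have := b.isLt; omega
    -- Only round `j` is used for the child: it is late enough for the induction hypothesis and, as
    -- `j < k ≤ b`, earlier than the root.
    have h0 := ih j hj (by omega) ⟨j, hjN⟩ le_rfl
    set H := tree r (j + 1)
    set S := {τ : H.V → Fin N | ¬ (τ H.root < b ∧ Robust H (j + 1) τ)}
    set R := {τ : H.V → Fin N | τ H.root = ⟨j, hjN⟩}
    set R' := {τ : H.V → Fin N | τ H.root = ⟨j, hjN⟩ ∧ ¬ Robust H (j + 1) τ}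
    have h1 : (N : ℝ) * R.ncard = (N : ℝ) ^ Fintype.card H.V := by
      exact_mod_cast card_mul_ncard_apply_eq H.root (⟨j, hjN⟩ : Fin N)
    have h2 : R ⊆ Sᶜ ∪ R' := by
      intro τ hτ
      by_cases hr : Robust H (j + 1) τ
      · refine Or.inl fun hS => hS ⟨?_, hr⟩
        rw [show τ H.root = _ from hτ, Fin.lt_def]
        exact lt_of_lt_of_le hj hb
      · exact Or.inr ⟨hτ, hr⟩
    have h3 : (R.ncard : ℝ) ≤ Sᶜ.ncard + R'.ncard := by
      exact_mod_cast (Set.ncard_le_ncard h2 (Set.toFinite _)).trans (Set.ncard_union_le _ _)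
    have h4 : (S.ncard : ℝ) + Sᶜ.ncard = (N : ℝ) ^ Fintype.card H.V := by
      have := Set.ncard_add_ncard_compl S
      rw [Nat.card_eq_fintype_card, Fintype.card_fun, Fintype.card_fin] at this
      exact_mod_cast this
    have h5 : (j : ℝ) * q ^ r ≤ 1 / 2 :=
      (mul_le_mul_of_nonneg_right (by exact_mod_cast (by omega : j ≤ K)) (pow_nonneg hq0 r)).trans hK
    set X : ℝ := (N : ℝ) ^ Fintype.card H.V
    have hX : 0 ≤ X := by positivity
    have h6 : (j : ℝ) * q ^ r * X ≤ 1 / 2 * X := mul_le_mul_of_nonneg_right h5 hX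
    have h7 : (N : ℝ) * R.ncard ≤ N * (Sᶜ.ncard + R'.ncard) :=
      mul_le_mul_of_nonneg_left h3 (by linarith)
    -- `N |R| = X` and `N |R'| ≤ X / 2`, which leaves at least `X / 2` for `N |Sᶜ|`.
    have h8 : 1 / (2 * N) * X ≤ Sᶜ.ncard := by
      rw [div_mul_eq_mul_div, div_le_iff₀ (by linarith)]
      nlinarith
    have : q * X = X - 1 / (2 * N) * X := by rw [hq]; ring
    linarith
  obtain ⟨t, ht, hroot, hlt⟩ := exists_isRanking_tree r k
  have hmax : ∀ v, t v ≤ k + 1 := fun v => by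
    by_cases hv : v = (tree r (k + 1)).root
    · rw [hv, hroot]
    · exact (hlt v hv).le
  clear hlt ih
  revert t
  rw [tree_succ r k]
  set F : Fin k × Fin r → RootedGraph := fun p => tree r (p.1.val + 1) with hF
  intro t ht hroot hmax
  -- `bad j` restricts only the `r` copies of type `j + 1`; the others contribute their full count,
  -- hence the factor `q ^ r`.
  let bad : Fin k → ∀ p, Set ((F p).V → Fin N) := fun j p =>
    {τ | p.1 = j → ¬ (τ (F p).root < b ∧ Robust (F p) (p.1.val + 1) τ)}
  have hsub : {τ : (join F).V → Fin N | τ (join F).root = b ∧ ¬ Robust (join F) (k + 1) τ} ⊆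
      ⋃ j ∈ (Finset.univ : Finset (Fin k)), {τ : (join F).V → Fin N | τ (none : Option _) = b ∧
        ∀ i, (fun x => τ (some ⟨i, x⟩ : Option _)) ∈ bad j i} := by
    rintro τ ⟨hb', hrob⟩
    by_contra hc
    simp only [Finset.mem_univ, Set.iUnion_true, Set.mem_iUnion, not_exists] at hc
    refine hrob (Robust.join ht hroot hmax fun j hj => ?_)
    by_contra! hcon
    refine hc ⟨j, hj⟩ ⟨hb', ?_⟩
    rintro p hp ⟨hp1, hp2⟩
    have hpj : p.1.val = j := by rw [hp]
    refine hcon p ?_ ?_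
    · rw [show τ (none : Option _) = b from hb']; exact hp1
    · rw [← hpj]; exact hp2
  have hprod : ∀ j : Fin k, ((∏ p, (bad j p).ncard : ℕ) : ℝ) ≤
      q ^ r * ∏ p, (N : ℝ) ^ Fintype.card (F p).V := by
    intro j
    have hle : ∀ p, ((bad j p).ncard : ℝ) ≤
        (if p.1 = j then q else 1) * (N : ℝ) ^ Fintype.card (F p).V := by
      intro p
      by_cases hp : p.1 = j
      · rw [if_pos hp]
        have := child p.1.val p.1.isLt
        have hb : bad j p = {τ : (F p).V → Fin N | ¬ (τ (F p).root < b ∧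
            Robust (F p) (p.1.val + 1) τ)} := by
          ext τ
          exact ⟨fun h => h hp, fun h _ => h⟩
        rw [hb]
        exact this
      · rw [if_neg hp, one_mul]
        have := Set.ncard_le_card (bad j p)
        rw [Nat.card_eq_fintype_card, Fintype.card_fun, Fintype.card_fin] at this
        exact_mod_cast this
    rw [Nat.cast_prod]
    refine (Finset.prod_le_prod (fun p _ => Nat.cast_nonneg _) fun p _ => hle p).trans_eq ?_
    rw [Finset.prod_mul_distrib]
    congr 1
    rw [Fintype.prod_prod_type]
    have hrow : ∀ x : Fin k, ∏ y : Fin r, (if (x, y).1 = j then q else 1) =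
        if x = j then q ^ r else 1 := by
      intro x
      by_cases hx : x = j <;> simp [hx]
    rw [Finset.prod_congr rfl fun x _ => hrow x, Finset.prod_ite_eq' Finset.univ j fun _ => q ^ r,
      if_pos (Finset.mem_univ j)]
  have hT : (N : ℝ) ^ Fintype.card (join F).V = N * ∏ p, (N : ℝ) ^ Fintype.card (F p).V := by
    rw [card_join, pow_succ, mul_comm, Finset.prod_pow_eq_pow_sum]
  have hcount : ({τ : (join F).V → Fin N | τ (join F).root = b ∧
      ¬ Robust (join F) (k + 1) τ}.ncard : ℝ) ≤ k * (q ^ r * ∏ p, (N : ℝ) ^ Fintype.card (F p).V) := by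
    calc _ ≤ ((∑ j : Fin k, ∏ p, (bad j p).ncard : ℕ) : ℝ) := by
          refine Nat.cast_le.2 ((Set.ncard_le_ncard hsub (Set.toFinite _)).trans
            ((Finset.set_ncard_biUnion_le _ _).trans (Finset.sum_le_sum fun j _ => ?_)))
          exact ncard_join_le F b (bad j)
      _ ≤ ∑ j : Fin k, q ^ r * ∏ p, (N : ℝ) ^ Fintype.card (F p).V := by
          rw [Nat.cast_sum]
          exact Finset.sum_le_sum fun j _ => hprod j
      _ = _ := by simp
  rw [hT]
  calc _ ≤ (N : ℝ) * (k * (q ^ r * ∏ p, (N : ℝ) ^ Fintype.card (F p).V)) :=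
        mul_le_mul_of_nonneg_left hcount (by linarith)
    _ = _ := by ring

theorem ncard_not_robust_le {r N k : ℕ} (hN : 1 ≤ N)
    (hk : (k : ℝ) * (1 - 1 / (2 * N)) ^ r ≤ 1 / 2) :
    ({τ : (tree r (k + 1)).V → Fin N | ¬ Robust (tree r (k + 1)) (k + 1) τ}.ncard : ℝ) ≤
      (k / N + k * (1 - 1 / (2 * N)) ^ r) * (N : ℝ) ^ Fintype.card (tree r (k + 1)).V := by
  classical
  have hN' : (1 : ℝ) ≤ N := by exact_mod_cast hN
  set H := tree r (k + 1)
  set X : ℝ := (N : ℝ) ^ Fintype.card H.V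
  set β : ℝ := (1 - 1 / (2 * N)) ^ r
  have hβ : 0 ≤ β := by
    have : 1 / (2 * (N : ℝ)) ≤ 1 := by
      rw [div_le_one (by linarith)]; linarith
    exact pow_nonneg (by linarith) r
  have hX : 0 ≤ X := by positivity
  -- Rounds below `k` are given up entirely, which produces the term `k / N`.
  have hfib : ∀ b : Fin N, ({τ : H.V → Fin N | τ H.root = b ∧ ¬ Robust H (k + 1) τ}.ncard : ℝ) ≤
      (if b.val < k then X / N else 0) + k * β * X / N := by
    intro b
    have h0 : 0 ≤ k * β * X / N := by positivity
    split_ifs with hb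
    · have h1 : (N : ℝ) * {τ : H.V → Fin N | τ H.root = b}.ncard =
          (N : ℝ) ^ Fintype.card H.V := by
        exact_mod_cast card_mul_ncard_apply_eq H.root b
      have h2 : ({τ : H.V → Fin N | τ H.root = b ∧ ¬ Robust H (k + 1) τ}.ncard : ℝ) ≤
          {τ : H.V → Fin N | τ H.root = b}.ncard := by
        have hsub : {τ : H.V → Fin N | τ H.root = b ∧ ¬ Robust H (k + 1) τ} ⊆
            {τ : H.V → Fin N | τ H.root = b} := fun τ h => h.1
        exact_mod_cast Set.ncard_le_ncard hsub (Set.toFinite _)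
      have h3 : ({τ : H.V → Fin N | τ H.root = b}.ncard : ℝ) = X / N := by
        rw [eq_div_iff (by linarith), mul_comm]; exact h1
      linarith
    · rw [zero_add, le_div_iff₀ (by linarith), mul_comm]
      exact ncard_not_robust_tree_le hk k le_rfl b (by omega)
  have hsub : {τ : H.V → Fin N | ¬ Robust H (k + 1) τ} ⊆
      ⋃ b ∈ (Finset.univ : Finset (Fin N)),
        {τ : H.V → Fin N | τ H.root = b ∧ ¬ Robust H (k + 1) τ} := by
    intro τ hτ
    simp only [Finset.mem_univ, Set.iUnion_true, Set.mem_iUnion]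
    exact ⟨_, rfl, hτ⟩
  have hlt : ((Finset.univ.filter fun b : Fin N => b.val < k).card : ℝ) ≤ k := by
    have : (Finset.univ.filter fun b : Fin N => b.val < k).card ≤ (Finset.range k).card :=
      Finset.card_le_card_of_injOn (fun b => b.val) (fun b hb => by simpa using hb)
        fun a _ b _ h => Fin.ext h
    rw [Finset.card_range] at this
    exact_mod_cast this
  calc _ ≤ ∑ b : Fin N, ({τ : H.V → Fin N | τ H.root = b ∧ ¬ Robust H (k + 1) τ}.ncard : ℝ) := by
        exact_mod_cast (Set.ncard_le_ncard hsub (Set.toFinite _)).trans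
          (Finset.set_ncard_biUnion_le _ _)
    _ ≤ ∑ b : Fin N, ((if b.val < k then X / N else 0) + k * β * X / N) :=
        Finset.sum_le_sum fun b _ => hfib b
    _ = (Finset.univ.filter fun b : Fin N => b.val < k).card * (X / N) + k * β * X := by
        rw [Finset.sum_add_distrib, ← Finset.sum_filter, Finset.sum_const, Finset.sum_const,
          Finset.card_univ, Fintype.card_fin, nsmul_eq_mul, nsmul_eq_mul]
        congr 1
        field_simp
    _ ≤ k * (X / N) + k * β * X := by
        have : 0 ≤ X / N := by positivity
        gcongr
    _ = _ := by ring

/-! ### Numbers of colors, and robustness inside a larger graph -/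

theorem le_numColors {V : Type} [Fintype V] {G : SimpleGraph V} {σ : Presentation V} {v : V} {k : ℕ}
    (h : color G σ v = k) : k ≤ numColors G σ := by
  have hsub : Set.Icc 1 k ⊆ Set.range (color G σ) := by
    rintro i ⟨h1, h2⟩
    rcases h2.eq_or_lt with rfl | h2
    · exact ⟨v, h⟩
    · rw [← h, color_eq_ffColor] at h2
      obtain ⟨u, -, -, hu⟩ := exists_ffColor_eq_of_lt h1 h2
      exact ⟨u, by rw [color_eq_ffColor, hu]⟩
  have := Set.ncard_le_ncard hsub (Set.toFinite _)
  rwa [← Finset.coe_Icc, Set.ncard_coe_finset, Nat.card_Icc, Nat.add_sub_cancel] at this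

theorem numColors_le {V : Type} [Fintype V] {G : SimpleGraph V} {σ : Presentation V} {k : ℕ}
    (h : ∀ v, color G σ v ≤ k) : numColors G σ ≤ k := by
  have hsub : Set.range (color G σ) ⊆ Set.Icc 1 k := by
    rintro _ ⟨v, rfl⟩
    refine ⟨?_, h v⟩
    rw [color_eq_ffColor]
    exact one_le_ffColor G _ v
  have := Set.ncard_le_ncard hsub (Set.finite_Icc 1 k)
  rwa [← Finset.coe_Icc, Set.ncard_coe_finset, Nat.card_Icc, Nat.add_sub_cancel] at this

theorem numColors_tree_le (r k : ℕ) (σ : Presentation (tree r (k + 1)).V) :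
    numColors (tree r (k + 1)).graph σ ≤ k + 1 := by
  obtain ⟨t, ht, hroot, hlt⟩ := exists_isRanking_tree r k
  refine numColors_le fun v => ?_
  rw [color_eq_ffColor]
  by_cases hv : v = (tree r (k + 1)).root
  · rw [hv]
    refine (ht.ffColor_le_of_forall _ _ fun u _ hu => ?_).trans_eq hroot
    by_cases hur : u = (tree r (k + 1)).root
    · rw [hur]
    · have := hlt u hur
      omega
  · exact (ht.ffColor_le_add_one _ v).trans (hlt v hv)

/-- Rounds of the vertices outside the image of `e` are free. -/
theorem ncard_comp_mem_le {V W : Type} [Fintype V] [Fintype W] {N : ℕ} (e : W ↪ V)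
    (S : Set (W → Fin N)) : {τ : V → Fin N | τ ∘ e ∈ S}.ncard ≤
      S.ncard * N ^ (Fintype.card V - Fintype.card W) := by
  classical
  have hcard : (Set.univ : Set ({v // v ∉ Set.range e} → Fin N)).ncard =
      N ^ (Fintype.card V - Fintype.card W) := by
    rw [Set.ncard_univ, Nat.card_eq_fintype_card, Fintype.card_fun, Fintype.card_fin,
      Fintype.card_subtype_compl]
    congr 2
    exact Set.card_range_of_injective e.injective
  rw [← hcard, ← Set.ncard_prod]
  refine Set.ncard_le_ncard_of_injOn (fun τ => (τ ∘ e, fun v => τ v.1)) ?_ ?_ (Set.toFinite _)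
  · intro τ hτ
    exact ⟨hτ, Set.mem_univ _⟩
  · intro τ _ τ' _ h
    rw [Prod.mk.injEq] at h
    funext v
    by_cases hv : v ∈ Set.range e
    · obtain ⟨x, rfl⟩ := hv
      exact congrFun h.1 x
    · exact congrFun h.2 ⟨v, hv⟩

/-- If `G` contains `T^r_{k+1}` as a union of components, then First-Fit on `G` gives its root
color `k + 1` with high probability. -/
theorem one_sub_le_ncard_color_eq {V : Type} [Fintype V] (G : SimpleGraph V) {r N k : ℕ}
    (e : (tree r (k + 1)).V ↪ V)
    (he : ∀ x v, G.Adj (e x) v ↔ ∃ y, e y = v ∧ (tree r (k + 1)).graph.Adj x y) (hN : 1 ≤ N)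
    (hk : (k : ℝ) * (1 - 1 / (2 * N)) ^ r ≤ 1 / 2) :
    1 - (k / N + k * (1 - 1 / (2 * N)) ^ r) ≤
      ({σ : Presentation V | color G σ (e (tree r (k + 1)).root) = k + 1}.ncard : ℝ) /
        Nat.card (Presentation V) := by
  classical
  have hbad := ncard_not_robust_le hN hk
  generalize tree r (k + 1) = H at *
  set c : ℝ := k / N + k * (1 - 1 / (2 * N)) ^ r
  set B := {σ : Presentation V | color G σ (e H.root) = k + 1}
  set A := {τ : V → Fin N | Robust H (k + 1) (τ ∘ e)}
  have hle := Fintype.card_le_of_embedding e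
  have h1 := ncard_mul_le_of_respects A B fun τ hτ σ hσ => by
    change color G σ (e H.root) = k + 1
    rw [color_eq_ffColor, ffColor_comp H.graph e (σ (e H.root)).val (fun x _ v _ => he x v) _ le_rfl]
    exact hτ _ fun u v huv => hσ _ _ huv
  have hNpos : (0 : ℝ) < N := by exact_mod_cast hN
  have h2 : (Aᶜ.ncard : ℝ) ≤ c * (N : ℝ) ^ Fintype.card V := by
    have h3 : (Aᶜ.ncard : ℝ) ≤ ({τ : H.V → Fin N | ¬ Robust H (k + 1) τ}.ncard : ℝ) *
        (N : ℝ) ^ (Fintype.card V - Fintype.card H.V) := by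
      exact_mod_cast ncard_comp_mem_le e {τ : H.V → Fin N | ¬ Robust H (k + 1) τ}
    refine h3.trans ((mul_le_mul_of_nonneg_right hbad (by positivity)).trans_eq ?_)
    rw [mul_assoc, ← pow_add, Nat.add_sub_cancel' hle]
  have h4 : (A.ncard : ℝ) + Aᶜ.ncard = (N : ℝ) ^ Fintype.card V := by
    have := Set.ncard_add_ncard_compl A
    rw [Nat.card_eq_fintype_card, Fintype.card_fun, Fintype.card_fin] at this
    exact_mod_cast this
  have h5 : (A.ncard : ℝ) * Nat.card (Presentation V) ≤ B.ncard * (N : ℝ) ^ Fintype.card V := by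
    rw [Nat.card_eq_fintype_card (α := V → Fin N), Fintype.card_fun, Fintype.card_fin] at h1
    exact_mod_cast h1
  have hP : (0 : ℝ) < Nat.card (Presentation V) := by
    have : Nonempty (Presentation V) := ⟨Fintype.equivFin V⟩
    exact_mod_cast Nat.card_pos
  have hX : (0 : ℝ) < (N : ℝ) ^ Fintype.card V := by positivity
  rw [le_div_iff₀ hP]
  refine le_of_mul_le_mul_right ?_ hX
  refine le_trans ?_ h5
  have h6 : (1 - c) * (N : ℝ) ^ Fintype.card V ≤ A.ncard := by linarith
  nlinarith

/-! ### Choice of parameters -/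

theorem one_le_log {k : ℕ} (hk : 3 ≤ k) : 1 ≤ Real.log k := by
  have hk' : (3 : ℝ) ≤ k := by exact_mod_cast hk
  rw [Real.le_log_iff_exp_le (by linarith)]
  linarith [Real.exp_one_lt_d9]

/-- The number of rounds into which the time is divided. -/
noncomputable def rounds (k : ℕ) : ℕ := ⌈2 * (k : ℝ) * Real.log k⌉₊

theorem mul_pow_copies_le {k : ℕ} (hk : 3 ≤ k) :
    ((k - 1 : ℕ) : ℝ) * (1 - 1 / (2 * rounds k)) ^ copies k ≤ 1 / k := by
  have hL := one_le_log hk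
  have hk' : (3 : ℝ) ≤ k := by exact_mod_cast hk
  set L := Real.log k with hLdef
  set N := rounds k
  set r := copies k
  have hN1 : 2 * k * L ≤ (N : ℝ) := Nat.le_ceil _
  have hN2 : (N : ℝ) < 2 * k * L + 1 := Nat.ceil_lt_add_one (by positivity)
  have hr : 10 * k * L ^ 3 ≤ (r : ℝ) := Nat.le_ceil _
  have hkL : 3 ≤ k * L := by nlinarith
  have hN0 : (1 : ℝ) ≤ N := by nlinarith
  have hexp : (1 - 1 / (2 * (N : ℝ))) ^ r ≤ Real.exp (-(2 * L)) := by
    have h1 : 1 - 1 / (2 * (N : ℝ)) ≤ Real.exp (-(1 / (2 * N))) :=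
      Real.one_sub_le_exp_neg _
    have h0 : 0 ≤ 1 - 1 / (2 * (N : ℝ)) := by
      have : 1 / (2 * (N : ℝ)) ≤ 1 := by
        rw [div_le_one (by linarith)]; linarith
      linarith
    refine (pow_le_pow_left₀ h0 h1 r).trans ?_
    rw [← Real.exp_nat_mul, Real.exp_le_exp]
    -- Source of the constant 10: `4 L N ≤ 8 k L² + 4 L ≤ 10 k L³`, as `L ≥ 1` and `k ≥ 3`.
    have h2 : 2 * L * (2 * N) ≤ r := by
      have h3 : 2 * L * (2 * N) ≤ 2 * L * (2 * (2 * k * L + 1)) := by gcongr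
      have h4 : L ^ 2 ≤ L ^ 3 := pow_le_pow_right₀ hL (by norm_num)
      have h5 : L ≤ L ^ 3 := le_self_pow₀ hL (by norm_num)
      have h6 : k * L ^ 2 ≤ k * L ^ 3 := by gcongr
      have h7 : 3 * L ^ 3 ≤ k * L ^ 3 := by gcongr
      nlinarith
    have h8 : 2 * L ≤ r * (1 / (2 * N)) := by
      rw [mul_one_div, le_div_iff₀ (by linarith)]; exact h2
    linarith
  have hexp2 : Real.exp (-(2 * L)) = 1 / k ^ 2 := by
    rw [Real.exp_neg, two_mul, Real.exp_add, hLdef, Real.exp_log (by linarith)]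
    rw [one_div, sq]
  have hk1 : ((k - 1 : ℕ) : ℝ) ≤ k := by exact_mod_cast Nat.sub_le k 1
  calc _ ≤ (k : ℝ) * (1 / k ^ 2) := by
        rw [← hexp2]
        exact mul_le_mul hk1 hexp (pow_nonneg (by
          have : 1 / (2 * (N : ℝ)) ≤ 1 := by
            rw [div_le_one (by linarith)]; linarith
          linarith) _) (by linarith)
    _ = 1 / k := by
        field_simp

theorem failure_le {k : ℕ} (hk : 3 ≤ k) :
    ((k - 1 : ℕ) : ℝ) / rounds k + ((k - 1 : ℕ) : ℝ) * (1 - 1 / (2 * rounds k)) ^ copies k ≤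
      1 / Real.log k := by
  have h1 := mul_pow_copies_le hk
  have hL := one_le_log hk
  have hk' : (3 : ℝ) ≤ k := by exact_mod_cast hk
  have hN1 : 2 * k * Real.log k ≤ (rounds k : ℝ) := Nat.le_ceil _
  have hk1 : ((k - 1 : ℕ) : ℝ) ≤ k := by exact_mod_cast Nat.sub_le k 1
  have h2 : ((k - 1 : ℕ) : ℝ) / rounds k ≤ 1 / (2 * Real.log k) := by
    rw [div_le_div_iff₀ (by nlinarith) (by linarith)]
    nlinarith
  have h3 : 1 / (k : ℝ) ≤ 1 / (2 * Real.log k) := by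
    refine one_div_le_one_div_of_le (by linarith) ?_
    -- `ln (k / 2) ≤ k / 2 - 1` and `ln 2 < 1` give `2 ln k ≤ k`.
    have h4 := Real.log_le_sub_one_of_pos (x := (k : ℝ) / 2) (by linarith)
    rw [Real.log_div (by linarith) (by norm_num)] at h4
    linarith [Real.log_two_lt_d9]
  have h5 : 1 / Real.log k = 1 / (2 * Real.log k) + 1 / (2 * Real.log k) := by
    field_simp; norm_num
  linarith

theorem one_sub_le_of_embedding {V : Type} [Fintype V] (G : SimpleGraph V) {k : ℕ} (hk : 3 ≤ k)
    (e : (tree (copies k) k).V ↪ V)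
    (he : ∀ x v, G.Adj (e x) v ↔ ∃ y, e y = v ∧ (tree (copies k) k).graph.Adj x y) :
    1 - 1 / Real.log k ≤
      ({σ : Presentation V | color G σ (e (tree (copies k) k).root) = k}.ncard : ℝ) /
        Nat.card (Presentation V) := by
  have hL := one_le_log hk
  have hk' : (3 : ℝ) ≤ k := by exact_mod_cast hk
  have h1 := mul_pow_copies_le hk
  have h2 := failure_le hk
  have h3 : 1 / (k : ℝ) ≤ 1 / 2 := one_div_le_one_div_of_le (by norm_num) (by linarith)
  have hN : 1 ≤ rounds k := Nat.one_le_ceil_iff.2 (by positivity)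
  generalize copies k = r at *
  generalize rounds k = N at *
  obtain ⟨m, rfl⟩ : ∃ m, k = m + 1 := ⟨k - 1, by omega⟩
  rw [Nat.add_sub_cancel] at h1 h2
  have := one_sub_le_ncard_color_eq G e he hN (h1.trans h3)
  linarith

theorem one_sub_le_prob_tree {k : ℕ} (hk : 3 ≤ k) : 1 - 1 / Real.log k ≤
    prob fun σ : Presentation (tree (copies k) k).V =>
      numColors (tree (copies k) k).graph σ = k := by
  refine (one_sub_le_of_embedding (tree (copies k) k).graph hk (Function.Embedding.refl _)
    fun x v => by simp).trans ?_
  rw [prob]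
  refine div_le_div_of_nonneg_right (Nat.cast_le.2 ?_) (Nat.cast_nonneg _)
  refine Set.ncard_le_ncard (fun σ hσ => ?_) (Set.toFinite _)
  have h1 := le_numColors hσ
  obtain ⟨m, hm⟩ : ∃ m, k = m + 1 := ⟨k - 1, by omega⟩
  have h2 : numColors (tree (copies k) k).graph σ ≤ k := by
    revert σ
    generalize copies k = r
    subst hm
    intro σ _ _
    exact numColors_tree_le r m σ
  exact le_antisymm h2 h1

/-! ### Performance ratios -/

theorem le_performanceRatio {V : Type} [Fintype V] {G : SimpleGraph V} {t : V → ℕ}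
    (ht : IsRanking G t) {k : ℕ} (hk : 3 ≤ k) (e : (tree (copies k) k).V ↪ V)
    (he : ∀ x v, G.Adj (e x) v ↔ ∃ y, e y = v ∧ (tree (copies k) k).graph.Adj x y) :
    (k : ℝ) / 2 * (1 - 1 / Real.log k) ≤ performanceRatio G := by
  classical
  have : Nonempty V := ⟨e (tree (copies k) k).root⟩
  have hχ := ht.colorable_two.chromaticNumber_le
  have hχ0 := ht.colorable_two.chromaticNumber_pos
  have hχ2 : G.chromaticNumber.toNat ≤ 2 := by
    simpa using ENat.toNat_le_toNat hχ (by simp)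
  -- Excludes the junk value 0 of `toNat`, for which the quotient would vanish.
  have hχ1 : 0 < G.chromaticNumber.toNat := by
    rw [Nat.pos_iff_ne_zero, Ne, ENat.toNat_eq_zero, not_or]
    exact ⟨hχ0.ne', ne_top_of_le_ne_top (by simp) hχ⟩
  have hprob := one_sub_le_of_embedding G hk e he
  set B := {σ : Presentation V | color G σ (e (tree (copies k) k).root) = k}
  have hterm : ∀ σ : Presentation V, (if σ ∈ B then (k : ℝ) / 2 else 0) ≤
      (numColors G σ : ℝ) / (G.chromaticNumber.toNat : ℝ) := by
    intro σ
    split_ifs with hσ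
    · have h1 : (k : ℝ) ≤ numColors G σ := by exact_mod_cast le_numColors hσ
      exact div_le_div₀ (by positivity) h1 (by exact_mod_cast hχ1) (by exact_mod_cast hχ2)
    · positivity
  rw [performanceRatio, Fintype.expect_eq_sum_div_card]
  refine le_trans ?_ (div_le_div_of_nonneg_right (Finset.sum_le_sum fun σ _ => hterm σ)
    (Nat.cast_nonneg _))
  have hB : ({σ ∈ (Finset.univ : Finset (Presentation V)) | σ ∈ B}.card : ℝ) = B.ncard := by
    rw [Set.ncard_eq_toFinset_card']
    congr 2
    ext σ
    simp
  rw [← Finset.sum_filter, Finset.sum_const, nsmul_eq_mul]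
  rw [Nat.card_eq_fintype_card] at hprob
  have h0 : (0 : ℝ) ≤ k / 2 := by positivity
  have := mul_le_mul_of_nonneg_left hprob h0
  refine this.trans_eq ?_
  rw [← hB, mul_div_assoc', mul_comm]

theorem exists_isRanking_tree' (r : ℕ) {k : ℕ} (hk : 1 ≤ k) :
    ∃ t, IsRanking (tree r k).graph t := by
  obtain ⟨m, rfl⟩ : ∃ m, k = m + 1 := ⟨k - 1, by omega⟩
  obtain ⟨t, ht, -⟩ := exists_isRanking_tree r m
  exact ⟨t, ht⟩

theorem le_performanceRatio_tree {k : ℕ} (hk : 3 ≤ k) :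
    (k : ℝ) / 2 * (1 - 1 / Real.log k) ≤ performanceRatio (tree (copies k) k).graph := by
  obtain ⟨t, ht⟩ := exists_isRanking_tree' (copies k) (by omega : 1 ≤ k)
  exact le_performanceRatio ht hk (Function.Embedding.refl _) fun x v => by simp

theorem le_RFF_forests {k n : ℕ} (hk : 3 ≤ k) (hn : (copies k + 1) ^ (k - 1) ≤ n) :
    (k : ℝ) / 2 * (1 - 1 / Real.log k) ≤ RFF forests n := by
  obtain ⟨t, ht⟩ := exists_isRanking_tree' (copies k) (by omega : 1 ≤ k)
  have hcard : Fintype.card (tree (copies k) k).V ≤ Fintype.card (Fin n) := by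
    rw [Fintype.card_fin]
    refine le_trans (le_of_eq ?_) hn
    obtain ⟨m, hm⟩ : ∃ m, k = m + 1 := ⟨k - 1, by omega⟩
    generalize copies k = r
    subst hm
    exact card_tree r m
  obtain ⟨e⟩ := Function.Embedding.nonempty_of_card_le hcard
  have hmap := ht.map e
  refine (le_performanceRatio hmap hk e fun x v => ?_).trans
    ((isGreatest_RFF forests n ⟨_, hmap.isAcyclic⟩).2 ⟨_, hmap.isAcyclic, rfl⟩)
  constructor
  · rintro ⟨-, x', y, hxy, hx, rfl⟩
    obtain rfl := e.injective hx
    exact ⟨y, rfl, hxy⟩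
  · rintro ⟨y, rfl, hxy⟩
    exact ⟨e.injective.ne hxy.ne, x, y, hxy, rfl, rfl⟩

/-! ### Asymptotics -/

open Filter Topology

/-- The error is the positive part of the actual deficit `1 / 2 - R n / X n`, so small `n` need no
estimate. -/
theorem exists_error_of_eventually_le {R X g : ℕ → ℝ} (hX : ∀ n, 3 ≤ n → 0 < X n)
    (hg : Tendsto g atTop (𝓝 (1 / 2))) (h : ∀ᶠ n in atTop, g n * X n ≤ R n) :
    ∃ ε : ℕ → ℝ, Tendsto ε atTop (𝓝 0) ∧ ∀ n, 3 ≤ n → (1 / 2 - ε n) * X n ≤ R n := by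
  refine ⟨fun n => max 0 (1 / 2 - R n / X n), ?_, fun n hn => ?_⟩
  · have h1 : Tendsto (fun n => max 0 (1 / 2 - g n)) atTop (𝓝 0) := by
      have := (tendsto_const_nhds (x := (0 : ℝ))).max (hg.const_sub (1 / 2))
      rwa [sub_self, max_self] at this
    refine tendsto_of_tendsto_of_tendsto_of_le_of_le' tendsto_const_nhds h1
      (Eventually.of_forall fun n => le_max_left _ _) ?_
    filter_upwards [h, eventually_ge_atTop 3] with n hn h3
    have : g n ≤ R n / X n := (le_div_iff₀ (hX n h3)).2 hn
    exact max_le_max le_rfl (by linarith)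
  · have h1 : 1 / 2 - max 0 (1 / 2 - R n / X n) ≤ R n / X n := by
      linarith [le_max_right 0 (1 / 2 - R n / X n)]
    exact (le_div_iff₀ (hX n hn)).1 h1

theorem log_div_log_log_pos {n : ℕ} (hn : 3 ≤ n) : 0 < Real.log n / Real.log (Real.log n) := by
  have hn' : (3 : ℝ) ≤ n := by exact_mod_cast hn
  have h1 : 1 < Real.log n := by
    rw [Real.lt_log_iff_exp_lt (by linarith)]
    linarith [Real.exp_one_lt_d9]
  exact div_pos (by linarith) (Real.log_pos h1)

theorem tendsto_log_natCast : Tendsto (fun n : ℕ => Real.log n) atTop atTop :=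
  Real.tendsto_log_atTop.comp tendsto_natCast_atTop_atTop

theorem log_copies_add_one_le : ∀ᶠ k : ℕ in atTop,
    Real.log (copies k + 1) ≤ Real.log k + 4 * Real.log (Real.log k) := by
  filter_upwards [tendsto_log_natCast.eventually_ge_atTop 11, eventually_ge_atTop 3] with k hL hk
  have hk' : (3 : ℝ) ≤ k := by exact_mod_cast hk
  set L := Real.log k
  have hr : (copies k : ℝ) < 10 * k * L ^ 3 + 1 := Nat.ceil_lt_add_one (by positivity)
  have h1 : (1 : ℝ) ≤ L ^ 3 := one_le_pow₀ (by linarith)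
  -- One spare factor `L ≥ 11` absorbs the 10 and the rounding.
  have h2 : (copies k : ℝ) + 1 ≤ k * L ^ 4 := by
    have h3 : (k : ℝ) * L ^ 4 = L * (k * L ^ 3) := by ring
    have h4 : 3 * 1 ≤ (k : ℝ) * L ^ 3 := mul_le_mul hk' h1 (by norm_num) (by linarith)
    have h5 : 11 * (k * L ^ 3) ≤ L * (k * L ^ 3) := mul_le_mul_of_nonneg_right hL (by linarith)
    linarith
  calc Real.log (copies k + 1) ≤ Real.log (k * L ^ 4) := Real.log_le_log (by positivity) h2
    _ = _ := by
      rw [Real.log_mul (by positivity) (by positivity), Real.log_pow]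
      norm_num [L]

theorem tendsto_div_add_log :
    Tendsto (fun y : ℝ => y / (y + 4 * Real.log y)) atTop (𝓝 1) := by
  have h1 : Tendsto (fun y : ℝ => Real.log y / y) atTop (𝓝 0) :=
    Real.isLittleO_log_id_atTop.tendsto_div_nhds_zero
  have h2 : Tendsto (fun y : ℝ => (1 + 4 * (Real.log y / y))⁻¹) atTop (𝓝 1) := by
    simpa using ((h1.const_mul 4).const_add 1).inv₀ (by norm_num)
  refine h2.congr' ?_
  filter_upwards [eventually_gt_atTop 0] with y hy
  rw [← inv_div]
  field_simp

theorem tendsto_one_sub_one_div : Tendsto (fun y : ℝ => 1 - 1 / y) atTop (𝓝 1) := by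
  simpa using tendsto_inv_atTop_zero.const_sub (1 : ℝ)

theorem exists_error_tree : ∃ ε : ℕ → ℝ, Tendsto ε atTop (𝓝 0) ∧
    ∀ k n : ℕ, 3 ≤ k → n = (copies k + 1) ^ (k - 1) →
      (1 / 2 - ε k) * (Real.log n / Real.log (Real.log n)) ≤
        performanceRatio (tree (copies k) k).graph := by
  have hcop : ∀ k : ℕ, 3 ≤ k → 30 ≤ (copies k : ℝ) := by
    intro k hk
    have hk' : (3 : ℝ) ≤ k := by exact_mod_cast hk
    have hL : 1 ≤ Real.log k ^ 3 := one_le_pow₀ (one_le_log hk)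
    have : 10 * (k : ℝ) * Real.log k ^ 3 ≤ copies k := Nat.le_ceil _
    nlinarith
  suffices h : ∃ ε : ℕ → ℝ, Tendsto ε atTop (𝓝 0) ∧ ∀ k : ℕ, 3 ≤ k →
      (1 / 2 - ε k) * (Real.log ((copies k + 1) ^ (k - 1) : ℕ) /
        Real.log (Real.log ((copies k + 1) ^ (k - 1) : ℕ))) ≤
        performanceRatio (tree (copies k) k).graph by
    obtain ⟨ε, hε, h⟩ := h
    exact ⟨ε, hε, fun k n hk hn => hn ▸ h k hk⟩
  refine exists_error_of_eventually_le (g := fun k : ℕ => 1 / 2 * ((1 - 1 / Real.log k) *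
    (Real.log k / (Real.log k + 4 * Real.log (Real.log k))))) (fun k hk => ?_) ?_ ?_
  · refine log_div_log_log_pos ?_
    have h1 : 30 ≤ copies k := by exact_mod_cast hcop k hk
    have h2 : (copies k + 1) ^ 1 ≤ (copies k + 1) ^ (k - 1) :=
      Nat.pow_le_pow_right (by omega) (by omega)
    rw [pow_one] at h2
    omega
  · have := ((tendsto_one_sub_one_div.mul tendsto_div_add_log).comp
      tendsto_log_natCast).const_mul (1 / 2)
    simpa using this
  · filter_upwards [log_copies_add_one_le, eventually_ge_atTop 3] with k hlog hk
    refine le_trans ?_ (le_performanceRatio_tree hk)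
    have hk' : (3 : ℝ) ≤ k := by exact_mod_cast hk
    have hL := one_le_log hk
    have hL2 := Real.log_nonneg hL
    have h30 := hcop k hk
    have hk1 : ((k - 1 : ℕ) : ℝ) = k - 1 := by
      rw [Nat.cast_sub (by omega), Nat.cast_one]
    have hlogn : Real.log ((copies k + 1) ^ (k - 1) : ℕ) = (k - 1) * Real.log (copies k + 1) := by
      push_cast
      rw [Real.log_pow, hk1]
    rw [hlogn]
    set M := Real.log ((copies k : ℝ) + 1)
    set L := Real.log (k : ℝ)
    have hM : 2 ≤ M := by
      rw [Real.le_log_iff_exp_le (by linarith), show (2 : ℝ) = 1 + 1 by norm_num, Real.exp_add]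
      nlinarith [Real.exp_one_lt_d9, Real.exp_pos 1]
    -- Gives `ln ln n_k ≥ ln k` for the denominator.
    have hy : (k : ℝ) ≤ (k - 1) * M := by nlinarith
    have hlogy : L ≤ Real.log ((k - 1) * M) := Real.log_le_log (by linarith) hy
    have hX : (k - 1) * M / Real.log ((k - 1) * M) ≤ k * (L + 4 * Real.log L) / L :=
      div_le_div₀ (by positivity) (mul_le_mul (by linarith) hlog (by linarith) (by linarith))
        (by linarith) hlogy
    have h0 : 0 ≤ 1 - 1 / L := by
      rw [sub_nonneg, div_le_one (by linarith)]; exact hL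
    calc _ ≤ 1 / 2 * ((1 - 1 / L) * (L / (L + 4 * Real.log L))) *
          (k * (L + 4 * Real.log L) / L) := mul_le_mul_of_nonneg_left hX (by positivity)
      _ = k / 2 * (1 - 1 / L) := by
          have : L + 4 * Real.log L ≠ 0 := by positivity
          field_simp

theorem exists_error_forests : ∃ ε : ℕ → ℝ, Tendsto ε atTop (𝓝 0) ∧
    ∀ n : ℕ, 3 ≤ n →
      (1 / 2 - ε n) * (Real.log n / Real.log (Real.log n)) ≤ RFF forests n := by
  set X : ℕ → ℝ := fun n => Real.log n / Real.log (Real.log n) with hXdef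
  -- `D n` bounds `ln (r + 1)` for the tree of index `κ n ≤ ln n`, so `κ n * D n ≤ ln n` makes that
  -- tree fit into `n` vertices; still `κ n` is asymptotic to `X n`.
  set D : ℕ → ℝ := fun n => Real.log (Real.log n) + 4 * Real.log (Real.log (Real.log n)) with hD
  set u : ℕ → ℝ := fun n => Real.log n / D n with hu
  set κ : ℕ → ℕ := fun n => ⌊u n⌋₊ with hκ
  have hx := tendsto_log_natCast
  have hl : Tendsto (fun n : ℕ => Real.log (Real.log n)) atTop atTop :=
    Real.tendsto_log_atTop.comp hx
  have hll : Tendsto (fun n : ℕ => Real.log (Real.log (Real.log n))) atTop atTop :=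
    Real.tendsto_log_atTop.comp hl
  have hXtop : Tendsto X atTop atTop := by
    have h1 : Tendsto (fun y : ℝ => Real.log y / y) atTop (𝓝[>] 0) := by
      refine tendsto_nhdsWithin_iff.2
        ⟨Real.isLittleO_log_id_atTop.tendsto_div_nhds_zero, ?_⟩
      filter_upwards [eventually_gt_atTop 1] with y hy
      exact div_pos (Real.log_pos hy) (by linarith)
    refine (h1.inv_tendsto_nhdsGT_zero.comp hx).congr fun n => ?_
    simp [X]
  have hratio : Tendsto (fun n => u n / X n) atTop (𝓝 1) := by
    refine (tendsto_div_add_log.comp hl).congr' ?_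
    filter_upwards [hx.eventually_gt_atTop 0, hl.eventually_gt_atTop 0,
      hll.eventually_gt_atTop 0] with n h1 h2 h3
    simp only [Function.comp_apply, u, X, D]
    field_simp
  have hutop : Tendsto u atTop atTop := by
    refine (hXtop.atTop_mul_pos one_pos hratio).congr' ?_
    filter_upwards [hXtop.eventually_gt_atTop 0] with n h1
    field_simp
  have hκtop : Tendsto κ atTop atTop := tendsto_nat_floor_atTop.comp hutop
  have hκX : Tendsto (fun n => (κ n : ℝ) / X n) atTop (𝓝 1) := by
    have := ((tendsto_nat_floor_div_atTop (R := ℝ)).comp hutop).mul hratio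
    rw [one_mul] at this
    refine this.congr' ?_
    filter_upwards [hutop.eventually_gt_atTop 0] with n h1
    simp only [Function.comp_apply, κ]
    field_simp
  refine exists_error_of_eventually_le (g := fun n => 1 / 2 * ((1 - 1 / Real.log (κ n)) *
    ((κ n : ℝ) / X n))) (fun n hn => log_div_log_log_pos hn) ?_ ?_
  · have := ((tendsto_one_sub_one_div.comp (tendsto_log_natCast.comp hκtop)).mul hκX).const_mul
      (1 / 2)
    simpa using this
  · filter_upwards [hκtop.eventually log_copies_add_one_le, hκtop.eventually_ge_atTop 3,
      hx.eventually_gt_atTop 0, hl.eventually_ge_atTop 1, hll.eventually_gt_atTop 0,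
      hXtop.eventually_gt_atTop 0, eventually_ge_atTop 1] with n hlog hk h1 h2 h3 h4 hn
    have hn' : (0 : ℝ) < n := by exact_mod_cast hn
    have hDpos : 1 ≤ D n := by simp only [hD]; linarith
    have hu0 : 0 ≤ u n := div_nonneg h1.le (by linarith)
    have hκu : (κ n : ℝ) ≤ u n := Nat.floor_le hu0
    have hκ3 : (3 : ℝ) ≤ κ n := by exact_mod_cast hk
    have hκx : (κ n : ℝ) ≤ Real.log n := hκu.trans (div_le_self h1.le hDpos)
    have hL1 := one_le_log hk
    have hL : Real.log (κ n) ≤ Real.log (Real.log n) := Real.log_le_log (by linarith) hκx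
    have hLL : Real.log (Real.log (κ n)) ≤ Real.log (Real.log (Real.log n)) :=
      Real.log_le_log (by linarith) hL
    have hcard : (copies (κ n) + 1) ^ (κ n - 1) ≤ n := by
      have h5 : Real.log ((copies (κ n) + 1) ^ (κ n - 1) : ℕ) ≤ Real.log n := by
        push_cast
        rw [Real.log_pow]
        have h6 : ((κ n - 1 : ℕ) : ℝ) ≤ u n :=
          le_trans (by exact_mod_cast Nat.sub_le _ _) hκu
        have h7 : Real.log ((copies (κ n) : ℝ) + 1) ≤ D n := by
          simp only [hD]; linarith
        calc _ ≤ u n * D n := mul_le_mul h6 h7 (Real.log_nonneg (by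
              linarith [(Nat.cast_nonneg (copies (κ n)) : (0 : ℝ) ≤ _)])) hu0
          _ = Real.log n := by
              simp only [hu]
              field_simp
      have h8 := (Real.log_le_log_iff (by positivity) hn').1 h5
      exact_mod_cast h8
    refine le_trans (le_of_eq ?_) (le_RFF_forests hk hcard)
    change 1 / 2 * ((1 - 1 / Real.log (κ n)) * ((κ n : ℝ) / X n)) * X n = _
    field_simp

end FirstFit

theorem mainTheorem3 :
    -- the lower bound `(1/2 - o(1)) ln n / ln ln n` for the class of forests
    (∃ ε : ℕ → ℝ, Filter.Tendsto ε Filter.atTop (nhds 0) ∧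
      ∀ n : ℕ, 3 ≤ n →
        (1 / 2 - ε n) * (Real.log n / Real.log (Real.log n)) ≤
          FirstFit.RFF FirstFit.forests n) ∧
    -- `T^r_k` is a tree with `(r+1)^(k-1)` vertices
    (∀ r k : ℕ, 1 ≤ k →
      (FirstFit.tree r k).graph.IsTree ∧
        Fintype.card (FirstFit.tree r k).V = (r + 1) ^ (k - 1)) ∧
    -- for `r = ⌈10 k ln³ k⌉`, First-Fit uses exactly `k` colors with probability `≥ 1 - 1 / ln k`
    (∀ k : ℕ, 3 ≤ k →
      1 - 1 / Real.log k ≤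
        FirstFit.prob fun σ : FirstFit.Presentation (FirstFit.tree (FirstFit.copies k) k).V =>
          FirstFit.numColors (FirstFit.tree (FirstFit.copies k) k).graph σ = k) ∧
    -- these trees, of order `n_k`, witness the lower bound
    (∃ ε : ℕ → ℝ, Filter.Tendsto ε Filter.atTop (nhds 0) ∧
      ∀ k n : ℕ, 3 ≤ k → n = Fintype.card (FirstFit.tree (FirstFit.copies k) k).V →
        (1 / 2 - ε k) * (Real.log n / Real.log (Real.log n)) ≤
          FirstFit.performanceRatio (FirstFit.tree (FirstFit.copies k) k).graph) := by
  refine ⟨FirstFit.exists_error_forests, fun r k hk => ?_, fun k hk => FirstFit.one_sub_le_prob_tree hk, ?_⟩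
  · obtain ⟨m, rfl⟩ : ∃ m, k = m + 1 := ⟨k - 1, by omega⟩
    exact ⟨FirstFit.tree_isTree r m, FirstFit.card_tree r m⟩
  · obtain ⟨ε, hε, h⟩ := FirstFit.exists_error_tree
    refine ⟨ε, hε, fun k n hk hn => h k n hk (hn.trans ?_)⟩
    generalize FirstFit.copies k = r
    obtain ⟨m, rfl⟩ : ∃ m, k = m + 1 := ⟨k - 1, by omega⟩
    exact FirstFit.card_tree r m
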